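/- Let $X(t)$, $t\in\mathbb R$, be a real-valued, mean-zero, (wide-sense) stationary, mean square continuous random process with covariance function $B(\tau)=\mathbf E\,X(t+\tau)X(t)=\int_{-\infty}^{\infty}e^{i\tau\lambda}\,dF(\lambda)$, where $F$ is the spectral function of $X$ (so $dF$ is a finite measure on $\mathbb R$). Let $0<\Lambda<\omega$, $T>0$, let $n\ge 1$ be an integer, and put \[X_n(t):=\sum_{k=-n}^{n}\frac{\sin\left(\omega\left(t-\frac{k\pi}{\omega}\right)\right)}{\omega\left(t-\frac{k\pi}{\omega}\right)}\,X\left(\frac{k\pi}{\omega}\right),\qquad z^*:=\frac{\omega^2T^2}{\pi^2n^2},\] where $\frac{\sin u}{u}$ is read as $1$ at $u=0$. If $z^*\in(0,1)$, then \[\sup_{t\in[0,T]}\left(\mathbf E\left|X(t)-X_n(t)\right|^2\right)^{1/2}\le \tilde A_n(T,\Lambda),\] where \[\tilde A_n(T,\Lambda):=\frac{\sqrt{\tilde C_n(T,\Lambda)}}{n}+\tilde D_n(T)\left(\int_{|\lambda|>\Lambda}dF(\lambda)\right)^{1/2},\] \[\tilde C_n(T,\Lambda):=B(0)\left(\frac{4\omega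 T}{\pi^2(1-z^*)}+\frac{4\left(z^*+1+\frac1n\right)}{\pi(1-z^*)^2\left(1-\frac{\Lambda}{\omega}\right)}\right)^2,\] \[\tilde D_n(T):=2+\frac{2}{\pi}\left(1+\mathrm{Si}(\pi)+\frac{\frac{\omega T}{\pi}+\frac12}{n-\frac{\omega T}{\pi}}\right),\qquad \mathrm{Si}(\pi)=\int_0^{\pi}\frac{\sin x}{x}\,dx.\] -/

import Mathlib

open MeasureTheory Filter Topology

noncomputable section

namespace WKS

/-- A real-valued process `X(t)`, `t ∈ ℝ`, with finite second moments and mean zero, that is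
stationary (in the wide sense: its covariance `E X(t+τ) X(t)` does not depend on `t`) and
mean square continuous. -/
structure IsStationaryProcess {Ω : Type*} [MeasurableSpace Ω] (P : Measure Ω)
    (X : ℝ → Ω → ℝ) : Prop where
  memLp : ∀ t, MemLp (X t) 2 P
  mean_zero : ∀ t, ∫ x, X t x ∂P = 0
  stationary : ∀ s t τ, ∫ x, X (s + τ) x * X s x ∂P = ∫ x, X (t + τ) x * X t x ∂P
  continuous_ms : ∀ t, Tendsto (fun s => ∫ x, |X s x - X t x| ^ 2 ∂P) (𝓝 t) (𝓝 0)

/-- The covariance function `B(τ) = E X(t+τ) X(t)` of a stationary process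
(read off at `t = 0`, since it does not depend on `t`). -/
def covariance {Ω : Type*} [MeasurableSpace Ω] (P : Measure Ω) (X : ℝ → Ω → ℝ) (τ : ℝ) : ℝ :=
  ∫ x, X (0 + τ) x * X 0 x ∂P

/-- `F` (the Lebesgue-Stieltjes measure `dF` of the spectral function) is the spectral measure of
the process `X`: `B(τ) = ∫ exp(iτl) dF(l)` for all real `τ`. By uniqueness of Fourier transforms
of finite measures, there is at most one finite `F` of this kind. -/
def IsSpectralMeasure {Ω : Type*} [MeasurableSpace Ω] (P : Measure Ω) (X : ℝ → Ω → ℝ)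
    (F : Measure ℝ) : Prop :=
  ∀ τ : ℝ, (covariance P X τ : ℂ) = ∫ l : ℝ, Complex.exp (Complex.I * τ * l) ∂F

/-- The truncated sampling series
`X_n(t) = ∑_{k=-n}^{n} sin(ω(t - kπ/ω)) / (ω(t - kπ/ω)) * X(kπ/ω)`, where `sin u / u` is `1`
at `u = 0`. -/
def truncated {Ω : Type*} (X : ℝ → Ω → ℝ) (ω : ℝ) (n : ℕ) (t : ℝ) (x : Ω) : ℝ :=
  ∑ k ∈ Finset.Icc (-(n : ℤ)) (n : ℤ),
    Real.sinc (ω * (t - k * Real.pi / ω)) * X (k * Real.pi / ω) x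

/-- The sine integral `Si(y) = ∫_0^y sin u / u du`. -/
def Si (y : ℝ) : ℝ := ∫ u in (0 : ℝ)..y, Real.sin u / u

/-- `z* = ω² T² / (π² n²)`. -/
def zStar (ω T : ℝ) (n : ℕ) : ℝ := ω ^ 2 * T ^ 2 / (Real.pi ^ 2 * (n : ℝ) ^ 2)

/-- The constant `C̃_n(T, Λ)`; the argument `B₀` is the variance `B(0)`. -/
def CTilde (B₀ ω : ℝ) (n : ℕ) (T Λ : ℝ) : ℝ :=
  B₀ * (4 * ω * T / (Real.pi ^ 2 * (1 - zStar ω T n)) +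
    4 * (zStar ω T n + 1 + 1 / (n : ℝ)) /
      (Real.pi * (1 - zStar ω T n) ^ 2 * (1 - Λ / ω))) ^ 2

/-- The constant `D̃_n(T)`. -/
def DTilde (ω : ℝ) (n : ℕ) (T : ℝ) : ℝ :=
  2 + 2 / Real.pi *
    (1 + Si Real.pi + (ω * T / Real.pi + 1 / 2) / ((n : ℝ) - ω * T / Real.pi))

/-- The bound `Ã_n(T, Λ) = √C̃_n(T, Λ) / n + D̃_n(T) (∫_{|l| > Λ} dF(l))^{1/2}`. -/
def ATilde (B₀ : ℝ) (F : Measure ℝ) (ω : ℝ) (n : ℕ) (T Λ : ℝ) : ℝ :=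
  Real.sqrt (CTilde B₀ ω n T Λ) / n + DTilde ω n T * Real.sqrt (F.real {l : ℝ | Λ < |l|})

/-- The mean square error `(E |X(t) - X_n(t)|²)^{1/2}`. -/
def rmsError {Ω : Type*} [MeasurableSpace Ω] (P : Measure Ω) (X : ℝ → Ω → ℝ)
    (ω : ℝ) (n : ℕ) (t : ℝ) : ℝ :=
  Real.sqrt (∫ x, |X t x - truncated X ω n t x| ^ 2 ∂P)

end WKS

end

namespace WKS

/-! With `s = ωt/π` and `θ = πl/ω`, the spectral measure turns the squared error into `∫ |e^{isθ} -
S_n(θ)|² dF(l)`, where `S_n` is the truncated cardinal series of `e^{isθ}` (`integral_sq_error_eq`).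
Two pointwise bounds on this kernel suffice (`sqrt_integral_sq_le`). In the band `|l| ≤ Λ`, `θ`
stays away from `±π`: the cardinal series converges to `e^{isθ}` (`tendsto_cardinalSum`), and
pairing the terms `±q` and summing by parts makes its tail `O(1/n)` (`norm_exp_sub_cardinalSum_le`).
This gives the `C̃` term. Outside the band convergence may fail, but `S_n` is bounded uniformly in
`θ` (`norm_cardinalSum_le`). Its only part not absolutely summable is essentially `∑ sin(jx)/j`,
whose partial sums are at most `Si(π)` in absolute value (`abs_sineSum_le`). Adding `|e^{isθ}| = 1`
gives `D̃`. -/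

/-! ### The sine integral. -/

theorem hasDerivAt_Si (y : ℝ) : HasDerivAt Si (Real.sinc y) y := by
  have h : Si = fun y => ∫ u in (0 : ℝ)..y, Real.sinc u := by
    funext y
    refine intervalIntegral.integral_congr_ae ?_
    -- At `u = 0` the quotient `sin u / u` is `0` by convention while `sinc` is `1`; one point does
    -- not affect the integral.
    have : ∀ᵐ u : ℝ, u ≠ 0 := by simp [ae_iff]
    filter_upwards [this] with u hu _
    rw [Real.sinc_of_ne_zero hu]
  rw [h]
  exact intervalIntegral.integral_hasDerivAt_right
    (Real.continuous_sinc.intervalIntegrable _ _)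
    (Real.continuous_sinc.stronglyMeasurableAtFilter _ _) Real.continuous_sinc.continuousAt

theorem Si_zero : Si 0 = 0 := by simp [Si]

theorem sinc_nonneg_of_le_pi {x : ℝ} (h0 : 0 ≤ x) (h1 : x ≤ Real.pi) : 0 ≤ Real.sinc x := by
  rcases h0.eq_or_lt with rfl | h
  · simp
  · rw [Real.sinc_of_ne_zero h.ne']
    exact div_nonneg (Real.sin_nonneg_of_nonneg_of_le_pi h0 h1) h0

theorem monotoneOn_Si : MonotoneOn Si (Set.Icc 0 Real.pi) := by
  refine monotoneOn_of_deriv_nonneg (convex_Icc _ _)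
    (fun y _ => (hasDerivAt_Si y).continuousAt.continuousWithinAt)
    (fun y _ => (hasDerivAt_Si y).differentiableAt.differentiableWithinAt) ?_
  intro x hx
  rw [interior_Icc] at hx
  rw [(hasDerivAt_Si x).deriv]
  exact sinc_nonneg_of_le_pi hx.1.le hx.2.le

theorem Si_pi_nonneg : 0 ≤ Si Real.pi := by
  rw [← Si_zero]
  exact monotoneOn_Si ⟨le_rfl, Real.pi_pos.le⟩ ⟨Real.pi_pos.le, le_rfl⟩ Real.pi_pos.le

/-- The sine integral attains its maximum over `[0, ∞)` at `π`. -/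
theorem Si_le_Si_pi {y : ℝ} (hy : 0 ≤ y) : Si y ≤ Si Real.pi := by
  rcases le_total y Real.pi with h | h
  · exact monotoneOn_Si ⟨hy, h⟩ ⟨Real.pi_pos.le, le_rfl⟩ h
  -- Adding `(cos y + 1)/y ≥ 0` makes `Si` antitone past `π` without changing its value at `π`.
  have hd : ∀ x ∈ Set.Ici Real.pi,
      HasDerivAt (fun y => Si y + (Real.cos y + 1) / y) (-(Real.cos x + 1) / x ^ 2) x := by
    intro x hx
    have hx0 : x ≠ 0 := (Real.pi_pos.trans_le hx).ne'
    have := (hasDerivAt_Si x).add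
      (((Real.hasDerivAt_cos x).add_const 1).div (hasDerivAt_id x) hx0)
    refine this.congr_deriv ?_
    rw [Real.sinc_of_ne_zero hx0]
    simp only [id]
    field_simp
    ring
  have hanti : AntitoneOn (fun y => Si y + (Real.cos y + 1) / y) (Set.Ici Real.pi) := by
    refine antitoneOn_of_deriv_nonpos (convex_Ici _)
      (fun y hy => (hd y hy).continuousAt.continuousWithinAt)
      (fun y hy => (hd y (interior_subset hy)).differentiableAt.differentiableWithinAt) ?_
    intro x hx
    rw [(hd x (interior_subset hx)).deriv]
    refine div_nonpos_of_nonpos_of_nonneg ?_ (sq_nonneg _)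
    linarith [Real.neg_one_le_cos x]
  have := hanti (Set.self_mem_Ici) h h
  simp only [Real.cos_pi, neg_add_cancel, zero_div, add_zero] at this
  have h2 : 0 ≤ (Real.cos y + 1) / y :=
    div_nonneg (by linarith [Real.neg_one_le_cos y]) hy
  linarith

/-! ### Partial sums of the sawtooth series. -/

/-- The partial sums `∑_{j=1}^N sin (j x) / j`. -/
noncomputable def sineSum (N : ℕ) (x : ℝ) : ℝ := ∑ j ∈ Finset.range N, Real.sin ((j + 1 : ℝ) * x) / (j + 1)

theorem hasDerivAt_sineSum (N : ℕ) (x : ℝ) :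
    HasDerivAt (sineSum N) (∑ j ∈ Finset.range N, Real.cos ((j + 1 : ℝ) * x)) x := by
  unfold sineSum
  refine HasDerivAt.fun_sum fun j _ => ?_
  have h0 : (j + 1 : ℝ) ≠ 0 := by positivity
  have := ((Real.hasDerivAt_sin ((j + 1 : ℝ) * x)).comp x
    ((hasDerivAt_id x).const_mul (j + 1 : ℝ))).div_const (j + 1 : ℝ)
  refine this.congr_deriv ?_
  field_simp

theorem two_sin_half_mul_sum_cos (N : ℕ) (x : ℝ) :
    2 * Real.sin (x / 2) * ∑ j ∈ Finset.range N, Real.cos ((j + 1 : ℝ) * x) =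
      Real.sin ((N + 1 / 2 : ℝ) * x) - Real.sin (x / 2) := by
  induction N with
  | zero => simp [div_eq_inv_mul]
  | succ N ih =>
    rw [Finset.sum_range_succ, mul_add, ih]
    have h1 : ((N + 1 : ℕ) + 1 / 2 : ℝ) * x = (N + 1 : ℝ) * x + x / 2 := by push_cast; ring
    have h2 : (N + 1 / 2 : ℝ) * x = (N + 1 : ℝ) * x - x / 2 := by ring
    rw [h1, h2, Real.sin_add, Real.sin_sub]
    ring

theorem sineSum_zero_right (N : ℕ) : sineSum N 0 = 0 := by simp [sineSum]

theorem sineSum_pi (N : ℕ) : sineSum N Real.pi = 0 := by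
  unfold sineSum
  refine Finset.sum_eq_zero fun j _ => ?_
  have := Real.sin_nat_mul_pi (j + 1)
  push_cast at this
  rw [this, zero_div]

/-- The Fejér–Jackson inequality. -/
theorem sineSum_nonneg (N : ℕ) : ∀ x ∈ Set.Icc 0 Real.pi, 0 ≤ sineSum N x := by
  induction N with
  | zero => simp [sineSum]
  | succ N ih =>
    have hc : ContinuousOn (sineSum (N + 1)) (Set.Icc 0 Real.pi) := fun y _ =>
      (hasDerivAt_sineSum (N + 1) y).continuousAt.continuousWithinAt
    obtain ⟨y, hy, hmin⟩ := isCompact_Icc.exists_isMinOn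
      (Set.nonempty_Icc.2 Real.pi_pos.le) hc
    suffices h : 0 ≤ sineSum (N + 1) y from fun x hx => h.trans (hmin hx)
    rcases hy.1.eq_or_lt with h0 | h0
    · rw [← h0, sineSum_zero_right]
    rcases hy.2.eq_or_lt with h1 | h1
    · rw [h1, sineSum_pi]
    -- At an interior minimum the derivative vanishes, so the Dirichlet kernel identity gives `sin α
    -- = sin (y/2)`. Then `sin ((N+1)y) = sin (y/2) (cos (y/2) - cos α) ≥ 0`: the last term is
    -- nonnegative there and induction covers the rest.
    have hloc : IsLocalMin (sineSum (N + 1)) y := hmin.isLocalMin (Icc_mem_nhds h0 h1)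
    have hder := hloc.hasDerivAt_eq_zero (hasDerivAt_sineSum (N + 1) y)
    have hD := two_sin_half_mul_sum_cos (N + 1) y
    rw [hder, mul_zero] at hD
    have hs : 0 ≤ Real.sin (y / 2) :=
      Real.sin_nonneg_of_nonneg_of_le_pi (by linarith) (by linarith)
    have hcos : 0 ≤ Real.cos (y / 2) :=
      Real.cos_nonneg_of_neg_pi_div_two_le_of_le (by linarith) (by linarith)
    set α := ((N + 1 : ℕ) + 1 / 2 : ℝ) * y with hα
    have hsin : 0 ≤ Real.sin ((N + 1 : ℝ) * y) := by
      have : (N + 1 : ℝ) * y = α - y / 2 := by rw [hα]; push_cast; ring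
      rw [this, Real.sin_sub, show Real.sin α = Real.sin (y / 2) by linarith]
      have hsq : Real.cos α ≤ Real.cos (y / 2) := by
        refine abs_le_of_sq_le_sq' ?_ hcos |>.2
        rw [Real.cos_sq', Real.cos_sq' (y / 2), show Real.sin α = Real.sin (y / 2) by linarith]
      nlinarith
    have hrec : sineSum (N + 1) y = sineSum N y + Real.sin ((N + 1 : ℝ) * y) / (N + 1) := by
      simp [sineSum, Finset.sum_range_succ]
    rw [hrec]
    have := ih y hy
    positivity

/-- Taken at `v = y/2`, this gives the sign of the derivative in `sineSum_le`, where `v - sin v` is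
multiplied by some `S` with `|S| ≤ 1`. -/
theorem sub_sin_le_mul_sin {v : ℝ} (h0 : 0 < v) (h1 : v ≤ Real.pi / 2) :
    v - Real.sin v ≤ v * Real.sin v := by
  have hj : 2 / Real.pi * v ≤ Real.sin v := Real.mul_le_sin h0.le h1
  have hpi := Real.pi_gt_three
  have hpi4 := Real.pi_le_four
  have hhalf : 1 / 2 * v ≤ Real.sin v := by
    refine le_trans (mul_le_mul_of_nonneg_right ?_ h0.le) hj
    rw [div_le_div_iff₀ (by norm_num) Real.pi_pos]
    linarith
  rcases le_total v 1 with h | h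
  · have := Real.sin_gt_sub_cube h0
    nlinarith [mul_pos h0 h0, mul_nonneg (mul_pos h0 h0).le (sub_nonneg.2 h)]
  · nlinarith

/-- Gronwall's bound for the partial sums of the sawtooth series. -/
theorem sineSum_le (N : ℕ) {x : ℝ} (hx : x ∈ Set.Icc 0 Real.pi) : sineSum N x ≤ Si Real.pi := by
  set M : ℝ := N + 1 / 2 with hM
  have hM0 : 0 < M := by positivity
  have hd : ∀ y, HasDerivAt (fun y => Si (M * y) - sineSum N y)
      (Real.sinc (M * y) * (M * 1) - ∑ j ∈ Finset.range N, Real.cos ((j + 1 : ℝ) * y)) y :=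
    fun y => ((hasDerivAt_Si (M * y)).comp y ((hasDerivAt_id y).const_mul M)).sub
      (hasDerivAt_sineSum N y)
  -- `Si (M y)` is the continuous analogue of the sum. The difference vanishes at `0` and increases,
  -- so the sum is at most `Si (M x) ≤ Si π`.
  have hmono : MonotoneOn (fun y => Si (M * y) - sineSum N y) (Set.Icc 0 Real.pi) := by
    refine monotoneOn_of_deriv_nonneg (convex_Icc _ _)
      (fun y _ => (hd y).continuousAt.continuousWithinAt)
      (fun y _ => (hd y).differentiableAt.differentiableWithinAt) ?_
    intro y hy
    rw [interior_Icc] at hy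
    obtain ⟨h0, h1⟩ := hy
    rw [(hd y).deriv]
    have hp : 0 < Real.sin (y / 2) := Real.sin_pos_of_pos_of_lt_pi (by linarith) (by linarith)
    have hD := two_sin_half_mul_sum_cos N y
    have hv := sub_sin_le_mul_sin (v := y / 2) (by linarith) (by linarith)
    have hv' := Real.sin_le (x := y / 2) (by linarith)
    have hS1 := Real.sin_le_one (M * y)
    have hS2 := Real.neg_one_le_sin (M * y)
    rw [← hM] at hD
    have hsum : ∑ j ∈ Finset.range N, Real.cos ((j + 1 : ℝ) * y) =
        (Real.sin (M * y) - Real.sin (y / 2)) / (2 * Real.sin (y / 2)) := by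
      rw [eq_div_iff (by positivity), ← hD]; ring
    rw [hsum, Real.sinc_of_ne_zero (by positivity)]
    set p := Real.sin (y / 2)
    set S := Real.sin (M * y)
    have : S / (M * y) * (M * 1) - (S - p) / (2 * p) =
        (y / 2 * p - S * (y / 2 - p)) / (y * p) := by
      field_simp
      ring
    rw [this]
    refine div_nonneg ?_ (by positivity)
    nlinarith
  have := hmono ⟨le_rfl, Real.pi_pos.le⟩ hx hx.1
  simp only [mul_zero, Si_zero, sineSum_zero_right, sub_zero] at this
  have h2 : Si (M * x) ≤ Si Real.pi := Si_le_Si_pi (mul_nonneg hM0.le hx.1)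
  linarith

theorem sineSum_neg (N : ℕ) (x : ℝ) : sineSum N (-x) = -sineSum N x := by
  simp [sineSum, neg_div]

theorem sineSum_periodic (N : ℕ) : Function.Periodic (sineSum N) (2 * Real.pi) := by
  intro x
  unfold sineSum
  refine Finset.sum_congr rfl fun j _ => ?_
  have : (j + 1 : ℝ) * (x + 2 * Real.pi) = (j + 1 : ℝ) * x + (j + 1 : ℕ) * (2 * Real.pi) := by
    push_cast; ring
  rw [this, Real.sin_add_nat_mul_two_pi]

theorem abs_sineSum_le (N : ℕ) (x : ℝ) : |sineSum N x| ≤ Si Real.pi := by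
  obtain ⟨y, hy, hxy⟩ := (sineSum_periodic N).exists_mem_Ico (by positivity : 0 < 2 * Real.pi) x
    (-Real.pi)
  rw [hxy]
  have key : ∀ z ∈ Set.Icc 0 Real.pi, |sineSum N z| ≤ Si Real.pi := fun z hz => by
    rw [abs_of_nonneg (sineSum_nonneg N z hz)]
    exact sineSum_le N hz
  rcases le_total 0 y with h | h
  · exact key y ⟨h, by linarith [hy.2]⟩
  · rw [← abs_neg, ← sineSum_neg]
    exact key (-y) ⟨by linarith, by linarith [hy.1]⟩


/-! ### Uniform bound for the truncated cardinal series. -/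

/-- The truncated cardinal series of `θ ↦ exp (i s θ)`. -/
noncomputable def cardinalSum (n : ℕ) (s θ : ℝ) : ℂ :=
  ∑ k ∈ Finset.Icc (-(n : ℤ)) n,
    (Real.sinc (Real.pi * (s - k)) : ℂ) * Complex.exp (Complex.I * k * θ)

theorem sum_Icc_neg_eq {M : Type*} [AddCommMonoid M] (g : ℤ → M) (N : ℕ) :
    ∑ k ∈ Finset.Icc (-(N : ℤ)) N, g k =
      g 0 + ∑ j ∈ Finset.range N, (g (j + 1) + g (-(j + 1))) := by
  induction N with
  | zero => simp
  | succ N ih =>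
    have : Finset.Icc (-((N + 1 : ℕ) : ℤ)) (N + 1 : ℕ) =
        insert ((N : ℤ) + 1) (insert (-((N : ℤ) + 1)) (Finset.Icc (-(N : ℤ)) N)) := by
      ext k; simp only [Finset.mem_Icc, Finset.mem_insert]; omega
    rw [this, Finset.sum_insert, Finset.sum_insert, ih, Finset.sum_range_succ]
    · rw [← add_assoc (g _), add_comm, add_assoc]
    · simp only [Finset.mem_Icc]; omega
    · simp only [Finset.mem_insert, Finset.mem_Icc]; omega

theorem mul_sinc (x : ℝ) : x * Real.sinc x = Real.sin x := by
  rcases eq_or_ne x 0 with rfl | h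
  · simp
  · rw [Real.sinc_of_ne_zero h]; field_simp

/-- Pairing separates a cosine part with coefficients `O(1/q²)`, summable absolutely, from a sine
part of order `1/q`, which needs cancellation. The sign `(-1)^q` of `sin (π(s ∓ q))` becomes the
shift of `θ` by `π`. -/
theorem sinc_mul_exp_pair (s θ : ℝ) (q : ℕ) (h1 : s - q ≠ 0) (h2 : s + q ≠ 0) :
    (Real.sinc (Real.pi * (s - q)) : ℂ) * Complex.exp (Complex.I * q * θ) +
      (Real.sinc (Real.pi * (s + q)) : ℂ) * Complex.exp (-(Complex.I * q * θ)) =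
    ((Real.sin (Real.pi * s) / Real.pi *
        (2 * s / (s ^ 2 - q ^ 2) * Real.cos (q * (θ + Real.pi))) : ℝ) : ℂ) +
      ((Real.sin (Real.pi * s) / Real.pi *
        (2 * q / (s ^ 2 - q ^ 2) * Real.sin (q * (θ + Real.pi))) : ℝ) : ℂ) * Complex.I := by
  have hpi := Real.pi_ne_zero
  have e1 : Real.sin (Real.pi * (s - q)) = (-1) ^ q * Real.sin (Real.pi * s) := by
    rw [mul_sub, mul_comm Real.pi (q : ℝ), Real.sin_sub_nat_mul_pi]
  have e2 : Real.sin (Real.pi * (s + q)) = (-1) ^ q * Real.sin (Real.pi * s) := by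
    rw [mul_add, mul_comm Real.pi (q : ℝ), Real.sin_add_nat_mul_pi]
  have e3 : Real.cos (q * (θ + Real.pi)) = (-1) ^ q * Real.cos (q * θ) := by
    rw [mul_add, Real.cos_add_nat_mul_pi]
  have e4 : Real.sin (q * (θ + Real.pi)) = (-1) ^ q * Real.sin (q * θ) := by
    rw [mul_add, Real.sin_add_nat_mul_pi]
  have h3 : s ^ 2 - (q : ℝ) ^ 2 ≠ 0 := by
    rw [sq_sub_sq]; exact mul_ne_zero h2 h1
  have f1 : Complex.exp (Complex.I * q * θ) =
      (Real.cos (q * θ) : ℂ) + (Real.sin (q * θ) : ℂ) * Complex.I := by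
    rw [show Complex.I * q * θ = ((q * θ : ℝ) : ℂ) * Complex.I by push_cast; ring,
      Complex.exp_mul_I, Complex.ofReal_cos, Complex.ofReal_sin]
  have f2 : Complex.exp (-(Complex.I * q * θ)) =
      (Real.cos (q * θ) : ℂ) - (Real.sin (q * θ) : ℂ) * Complex.I := by
    rw [show -(Complex.I * q * θ) = ((-(q * θ) : ℝ) : ℂ) * Complex.I by push_cast; ring,
      Complex.exp_mul_I, ← Complex.ofReal_cos, ← Complex.ofReal_sin, Real.cos_neg, Real.sin_neg]
    push_cast; ring
  rw [f1, f2, e3, e4, Real.sinc_of_ne_zero (mul_ne_zero hpi h1),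
    Real.sinc_of_ne_zero (mul_ne_zero hpi h2), e1, e2]
  generalize Real.cos (q * θ) = c
  generalize Real.sin (q * θ) = d
  apply Complex.ext
  · simp only [Complex.add_re, Complex.sub_re, Complex.mul_re, Complex.ofReal_re,
      Complex.ofReal_im, Complex.I_re, Complex.I_im, Complex.sub_im, Complex.add_im, Complex.mul_im]
    rw [sq_sub_sq]
    field_simp
    ring
  · simp only [Complex.add_re, Complex.sub_re, Complex.mul_re, Complex.ofReal_re,
      Complex.ofReal_im, Complex.I_re, Complex.I_im, Complex.sub_im, Complex.add_im, Complex.mul_im]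
    rw [sq_sub_sq]
    field_simp
    ring

theorem sum_inv_sq_sub_sq_le (N : ℕ) {δ : ℝ} (hδ : |δ| ≤ 1 / 2) :
    ∑ j ∈ Finset.range N, 1 / ((j + 1 : ℝ) ^ 2 - δ ^ 2) ≤ 2 := by
  have hsq : δ ^ 2 ≤ 1 / 4 := by rw [← sq_abs]; nlinarith [abs_nonneg δ]
  suffices h : ∑ j ∈ Finset.range N, 1 / ((j + 1 : ℝ) ^ 2 - δ ^ 2) ≤ 2 - 1 / (N + 1 / 2 : ℝ) by
    have : 0 ≤ 1 / (N + 1 / 2 : ℝ) := by positivity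
    linarith
  induction N with
  | zero => norm_num
  | succ N ih =>
    rw [Finset.sum_range_succ]
    have hN : (0 : ℝ) ≤ N := Nat.cast_nonneg N
    -- `(N+1)² - 1/4 = (N + 1/2)(N + 3/2)`, which telescopes.
    have h1 : 1 / ((N + 1 : ℝ) ^ 2 - δ ^ 2) ≤ 1 / ((N + 1 / 2 : ℝ) * (N + 3 / 2)) := by
      apply one_div_le_one_div_of_le (by positivity)
      nlinarith
    have h2 : 1 / ((N + 1 / 2 : ℝ) * (N + 3 / 2)) =
        1 / (N + 1 / 2 : ℝ) - 1 / ((N + 1 : ℕ) + 1 / 2 : ℝ) := by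
      push_cast
      rw [show (N + 1 + 1 / 2 : ℝ) = N + 3 / 2 by ring]
      field_simp
      ring
    linarith

/-- Bounding `sinc` and `sin` by `1` separately is too weak near `|δ| = 1/2`, where `4|δ| + 4|δ|² =
3 > 2`. The decay of `sinc` compensates: for `|δ| ≥ 3/10` multiply by `|δ|` and use `π|δ||sinc| =
|sin| ≤ 1`; below `3/10` use `|sin (πδ)| ≤ π|δ|`. -/
theorem abs_sinc_add_le {δ : ℝ} (hδ : |δ| ≤ 1 / 2) {A : ℝ} (hA : 0 ≤ A) :
    |Real.sinc (Real.pi * δ)| + |Real.sin (Real.pi * δ)| / Real.pi *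
      (4 * |δ| + 4 * |δ| ^ 2 + 2 * A) ≤ 1 + 2 / Real.pi * (1 + A) := by
  have hpi := Real.pi_gt_three
  have hpi4 := Real.pi_le_four
  have hp : |Real.sin (Real.pi * δ)| ≤ 1 := Real.abs_sin_le_one _
  have hs : |Real.sinc (Real.pi * δ)| ≤ 1 := Real.abs_sinc_le_one _
  have hps : |Real.sin (Real.pi * δ)| = Real.pi * |δ| * |Real.sinc (Real.pi * δ)| := by
    rw [← mul_sinc, abs_mul, abs_mul, abs_of_pos Real.pi_pos]
  have hd := abs_nonneg δ
  have hs0 := abs_nonneg (Real.sinc (Real.pi * δ))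
  have hp0 := abs_nonneg (Real.sin (Real.pi * δ))
  set d := |δ|
  set p := |Real.sin (Real.pi * δ)|
  set c := |Real.sinc (Real.pi * δ)|
  have h1 : p * A ≤ A := by nlinarith
  have key : c * Real.pi + p * (4 * d + 4 * d ^ 2) ≤ Real.pi + 2 := by
    rcases le_total d (3 / 10) with h | h
    · have e1 : 4 * d + 4 * d ^ 2 ≤ 156 / 100 := by nlinarith
      have e2 : p ≤ Real.pi * d := by rw [hps]; nlinarith [mul_nonneg Real.pi_pos.le hd]
      have e3 : c * Real.pi ≤ Real.pi := by nlinarith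
      have e4 : p * (4 * d + 4 * d ^ 2) ≤ (4 * (3 / 10)) * (156 / 100) :=
        mul_le_mul (e2.trans (mul_le_mul hpi4 h hd (by norm_num))) e1 (by positivity) (by norm_num)
      linarith
    · have hd0 : 0 < d := by linarith
      have e1 : 1 + 4 * d ^ 2 + 4 * d ^ 3 ≤ 5 * d := by
        nlinarith [mul_nonneg (sub_nonneg.2 h) (sub_nonneg.2 hδ),
          mul_nonneg (mul_nonneg (sub_nonneg.2 h) (sub_nonneg.2 hδ)) hd]
      have e2 : d * (c * Real.pi + p * (4 * d + 4 * d ^ 2)) ≤ d * (Real.pi + 2) := by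
        have : d * (c * Real.pi + p * (4 * d + 4 * d ^ 2)) = p * (1 + 4 * d ^ 2 + 4 * d ^ 3) := by
          rw [hps]; ring
        rw [this]
        have : p * (1 + 4 * d ^ 2 + 4 * d ^ 3) ≤ 1 * (5 * d) :=
          mul_le_mul hp e1 (by positivity) (by norm_num)
        nlinarith
      exact le_of_mul_le_mul_left e2 hd0
  have e : c + p / Real.pi * (4 * d + 4 * d ^ 2 + 2 * A) =
      (c * Real.pi + p * (4 * d + 4 * d ^ 2) + 2 * (p * A)) / Real.pi := by
    field_simp
    ring
  have e' : 1 + 2 / Real.pi * (1 + A) = (Real.pi + 2 + 2 * A) / Real.pi := by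
    field_simp; ring
  rw [e, e']
  gcongr ?_ / _
  linarith

theorem cardinalSum_eq (N : ℕ) (s θ : ℝ) (h : ∀ j < N, s - (j + 1 : ℕ) ≠ 0 ∧ s + (j + 1 : ℕ) ≠ 0) :
    cardinalSum N s θ = (Real.sinc (Real.pi * s) : ℂ) +
      (((Real.sin (Real.pi * s) / Real.pi * ∑ j ∈ Finset.range N,
        (2 * s / (s ^ 2 - (j + 1 : ℕ) ^ 2) * Real.cos ((j + 1 : ℕ) * (θ + Real.pi))) : ℝ) : ℂ) +
      ((Real.sin (Real.pi * s) / Real.pi * ∑ j ∈ Finset.range N,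
        (2 * (j + 1 : ℕ) / (s ^ 2 - (j + 1 : ℕ) ^ 2) *
          Real.sin ((j + 1 : ℕ) * (θ + Real.pi))) : ℝ) : ℂ) * Complex.I) := by
  unfold cardinalSum
  rw [sum_Icc_neg_eq]
  congr 1
  · simp
  · rw [Finset.mul_sum, Finset.mul_sum, Complex.ofReal_sum, Complex.ofReal_sum, Finset.sum_mul,
      ← Finset.sum_add_distrib]
    refine Finset.sum_congr rfl fun j hj => ?_
    obtain ⟨h1, h2⟩ := h j (Finset.mem_range.1 hj)
    rw [← sinc_mul_exp_pair s θ (j + 1) h1 h2]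
    push_cast
    congr 2
    · congr 3
      ring
    · congr 1
      ring

theorem norm_cardinalSum_le_of_abs_le_half (N : ℕ) {δ : ℝ} (hδ : |δ| ≤ 1 / 2) (θ : ℝ) :
    ‖cardinalSum N δ θ‖ ≤ 1 + 2 / Real.pi * (1 + Si Real.pi) := by
  have hδ' := abs_le.1 hδ
  have hsq : δ ^ 2 ≤ 1 / 4 := by rw [← sq_abs]; nlinarith [abs_nonneg δ]
  have hpos : ∀ j : ℕ, 0 < (j + 1 : ℝ) ^ 2 - δ ^ 2 := fun j => by
    have hN : (0 : ℝ) ≤ j := Nat.cast_nonneg j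
    nlinarith
  rw [cardinalSum_eq]
  swap
  · intro j _
    have hN : (0 : ℝ) ≤ j := Nat.cast_nonneg j
    push_cast
    constructor
    · linarith
    · linarith
  refine le_trans ?_ (abs_sinc_add_le hδ Si_pi_nonneg)
  refine (norm_add_le _ _).trans (add_le_add (by simp) ?_)
  refine (norm_add_le _ _).trans ?_
  rw [norm_mul, Complex.norm_I, mul_one, Complex.norm_real, Complex.norm_real, Real.norm_eq_abs,
    Real.norm_eq_abs, abs_mul, abs_mul, ← mul_add, abs_div, abs_of_pos Real.pi_pos]
  refine mul_le_mul_of_nonneg_left ?_ (by positivity)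
  have hsum := sum_inv_sq_sub_sq_le N hδ
  have hA : |∑ j ∈ Finset.range N, (2 * δ / (δ ^ 2 - (j + 1 : ℕ) ^ 2) *
      Real.cos ((j + 1 : ℕ) * (θ + Real.pi)))| ≤ 4 * |δ| := by
    calc _ ≤ ∑ j ∈ Finset.range N, 2 * |δ| * (1 / ((j + 1 : ℝ) ^ 2 - δ ^ 2)) := by
          refine (Finset.abs_sum_le_sum_abs _ _).trans (Finset.sum_le_sum fun j _ => ?_)
          rw [abs_mul]
          refine (mul_le_of_le_one_right (abs_nonneg _) (Real.abs_cos_le_one _)).trans_eq ?_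
          push_cast
          rw [abs_div, abs_mul, abs_two, abs_sub_comm, abs_of_pos (hpos j), mul_one_div]
      _ ≤ _ := by
          rw [← Finset.mul_sum]
          nlinarith [abs_nonneg δ]
  have hB : |∑ j ∈ Finset.range N, (2 * (j + 1 : ℕ) / (δ ^ 2 - (j + 1 : ℕ) ^ 2) *
      Real.sin ((j + 1 : ℕ) * (θ + Real.pi)))| ≤ 4 * |δ| ^ 2 + 2 * Si Real.pi := by
    -- `2q/(δ² - q²) = -2/q - 2δ²/(q(q² - δ²))`: a sawtooth sum plus an absolutely summable
    -- remainder.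
    have hsplit : ∑ j ∈ Finset.range N, (2 * (j + 1 : ℕ) / (δ ^ 2 - (j + 1 : ℕ) ^ 2) *
        Real.sin ((j + 1 : ℕ) * (θ + Real.pi))) =
        -(2 * sineSum N (θ + Real.pi)) - ∑ j ∈ Finset.range N,
          2 * δ ^ 2 * (1 / ((j + 1 : ℝ) ^ 2 - δ ^ 2)) *
            (Real.sin ((j + 1 : ℝ) * (θ + Real.pi)) / (j + 1)) := by
      unfold sineSum
      rw [Finset.mul_sum, ← Finset.sum_neg_distrib, ← Finset.sum_sub_distrib]
      refine Finset.sum_congr rfl fun j _ => ?_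
      have h1 := (hpos j).ne'
      have h2 : δ ^ 2 - (j + 1 : ℝ) ^ 2 ≠ 0 := by linarith [hpos j]
      have h3 : (j + 1 : ℝ) ≠ 0 := by positivity
      push_cast
      have h4 : δ ^ 2 - (j + 1 : ℝ) ^ 2 = -((j + 1 : ℝ) ^ 2 - δ ^ 2) := by ring
      rw [h4]
      generalize hX : (j + 1 : ℝ) ^ 2 - δ ^ 2 = X at *
      have : δ ^ 2 = (j + 1 : ℝ) ^ 2 - X := by linarith
      rw [this]
      field_simp
      ring
    have h1 := abs_sineSum_le N (θ + Real.pi)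
    have h2 : |∑ j ∈ Finset.range N, 2 * δ ^ 2 * (1 / ((j + 1 : ℝ) ^ 2 - δ ^ 2)) *
            (Real.sin ((j + 1 : ℝ) * (θ + Real.pi)) / (j + 1))| ≤ 4 * |δ| ^ 2 := by
      calc _ ≤ ∑ j ∈ Finset.range N, 2 * δ ^ 2 * (1 / ((j + 1 : ℝ) ^ 2 - δ ^ 2)) := by
            refine (Finset.abs_sum_le_sum_abs _ _).trans (Finset.sum_le_sum fun j _ => ?_)
            have h0 : 0 ≤ 2 * δ ^ 2 * (1 / ((j + 1 : ℝ) ^ 2 - δ ^ 2)) :=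
              mul_nonneg (by positivity) (one_div_nonneg.2 (hpos j).le)
            rw [abs_mul, abs_of_nonneg h0]
            refine mul_le_of_le_one_right h0 ?_
            rw [abs_div, abs_of_pos (by positivity : (0 : ℝ) < j + 1)]
            refine div_le_one_of_le₀ ((Real.abs_sin_le_one _).trans ?_) (by positivity)
            linarith [Nat.cast_nonneg (α := ℝ) j]
        _ ≤ _ := by
            rw [← Finset.mul_sum, sq_abs]
            nlinarith [sq_nonneg δ]
    rw [hsplit]
    refine (abs_sub _ _).trans ?_
    rw [abs_neg, abs_mul, abs_two]
    linarith
  linarith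

/-- A bound for the truncated cardinal series, uniform in `θ`. -/
theorem norm_cardinalSum_le {n : ℕ} {s a : ℝ} (hs : 0 ≤ s) (hsa : s ≤ a) (han : a < n) (θ : ℝ) :
    ‖cardinalSum n s θ‖ ≤ 1 + 2 / Real.pi * (1 + Si Real.pi + (a + 1 / 2) / (n - a)) := by
  have hna : 0 < (n : ℝ) - a := by linarith
  -- Recentre at the integer `m` nearest to `s`. With `N = n - m`, the window `[m-N, m+N]` reduces
  -- to the case `|δ| ≤ 1/2`. The `2m ≤ 2(a + 1/2)` leftover indices all lie to its left, at
  -- distance at least `n - a` from `s`.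
  obtain ⟨m, hm⟩ : ∃ m : ℕ, round s = m := by
    refine ⟨(round s).toNat, (Int.toNat_of_nonneg ?_).symm⟩
    rw [round_eq]
    exact Int.floor_nonneg.2 (by linarith)
  have hr : |s - m| ≤ 1 / 2 := by
    have := abs_sub_round s
    rw [hm] at this
    exact_mod_cast this
  have hr' := abs_le.1 hr
  have hmn : m ≤ n := by
    have : (m : ℝ) < n + 1 := by linarith
    exact Nat.lt_succ_iff.1 (by exact_mod_cast this)
  obtain ⟨N, rfl⟩ := Nat.exists_eq_add_of_le hmn
  set f : ℤ → ℂ := fun k =>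
    (Real.sinc (Real.pi * (s - k)) : ℂ) * Complex.exp (Complex.I * k * θ) with hf
  have hexp : ∀ k : ℤ, ‖Complex.exp (Complex.I * k * θ)‖ = 1 := fun k => by
    rw [show Complex.I * k * θ = ((k * θ : ℝ) : ℂ) * Complex.I by push_cast; ring,
      Complex.norm_exp_ofReal_mul_I]
  have hsplit : cardinalSum (m + N) s θ =
      ∑ k ∈ Finset.Ico (-((m + N : ℕ) : ℤ)) ((m : ℤ) - N), f k +
        ∑ k ∈ Finset.Icc ((m : ℤ) - N) (m + N), f k := by
    rw [← Finset.sum_union]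
    · refine Finset.sum_congr ?_ fun _ _ => rfl
      ext k
      simp only [Finset.mem_Icc, Finset.mem_union, Finset.mem_Ico]
      push_cast
      omega
    · rw [Finset.disjoint_left]
      intro k
      simp only [Finset.mem_Icc, Finset.mem_Ico]
      omega
  have hsym : ∑ k ∈ Finset.Icc ((m : ℤ) - N) (m + N), f k =
      Complex.exp (Complex.I * m * θ) * cardinalSum N (s - m) θ := by
    have : Finset.Icc ((m : ℤ) - N) (m + N) =
        (Finset.Icc (-(N : ℤ)) N).map (addLeftEmbedding (m : ℤ)) := by
      rw [Finset.map_add_left_Icc, sub_eq_add_neg]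
    rw [this, Finset.sum_map, cardinalSum, Finset.mul_sum]
    refine Finset.sum_congr rfl fun k _ => ?_
    simp only [hf, addLeftEmbedding_apply]
    push_cast
    rw [mul_left_comm, ← Complex.exp_add]
    congr 2
    · congr 2
      ring
    · ring
  have h1 : ‖∑ k ∈ Finset.Ico (-((m + N : ℕ) : ℤ)) ((m : ℤ) - N), f k‖ ≤
      2 / Real.pi * ((a + 1 / 2) / ((m + N : ℕ) - a)) := by
    have hterm : ∀ k ∈ Finset.Ico (-((m + N : ℕ) : ℤ)) ((m : ℤ) - N),
        ‖f k‖ ≤ 1 / (Real.pi * ((m + N : ℕ) - a)) := by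
      intro k hk
      have hk2 := (Finset.mem_Ico.1 hk).2
      have hk3 : (k : ℝ) ≤ m - N - 1 := by
        have : k ≤ (m : ℤ) - N - 1 := by omega
        exact_mod_cast this
      have hk4 : ((m + N : ℕ) : ℝ) - a ≤ s - k := by push_cast; linarith
      have hpos : 0 < Real.pi * (s - k) := mul_pos Real.pi_pos (by linarith)
      rw [norm_mul, hexp, mul_one, Complex.norm_real, Real.norm_eq_abs,
        Real.sinc_of_ne_zero hpos.ne', abs_div, abs_of_pos hpos]
      have := Real.abs_sin_le_one (Real.pi * (s - k))
      have hp := Real.pi_pos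
      gcongr
    refine (norm_sum_le_of_le _ hterm).trans ?_
    rw [Finset.sum_const, Int.card_Ico, nsmul_eq_mul]
    have hc : ((((m : ℤ) - N - -((m + N : ℕ) : ℤ)).toNat : ℕ) : ℝ) = 2 * m := by
      have : ((m : ℤ) - N - -((m + N : ℕ) : ℤ)).toNat = 2 * m := by push_cast; omega
      rw [this]; push_cast; ring
    rw [hc]
    have : 2 / Real.pi * ((a + 1 / 2) / ((m + N : ℕ) - a)) =
        (2 * (a + 1 / 2)) * (1 / (Real.pi * ((m + N : ℕ) - a))) := by
      field_simp
    rw [this]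
    refine mul_le_mul_of_nonneg_right (by linarith) ?_
    exact one_div_nonneg.2 (mul_pos Real.pi_pos hna).le
  have h2 := norm_cardinalSum_le_of_abs_le_half N hr θ
  rw [hsplit, hsym]
  refine (norm_add_le _ _).trans ?_
  have h3 := hexp m
  push_cast at h3
  rw [norm_mul, h3, one_mul, mul_add]
  linarith


/-! ### Convergence of the cardinal series for `|θ| < π`. -/

theorem tendsto_intervalIntegral_exp_mul_cocompact (a b : ℝ) (h : ℝ → ℂ) :
    Tendsto (fun w : ℝ => ∫ u in a..b, Complex.exp (Complex.I * w * u) * h u)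
      (cocompact ℝ) (𝓝 0) := by
  have h1 := Real.tendsto_integral_exp_smul_cocompact ((Set.uIoc a b).indicator h)
  -- The Riemann–Lebesgue lemma is stated with `e^{-2πiuw}`, hence the rescaling of `w` by
  -- `-1/(2π)`.
  have hne : -(1 / (2 * Real.pi)) ≠ 0 := by
    have := Real.pi_pos
    exact neg_ne_zero.2 (by positivity)
  have h2 : Tendsto (fun w : ℝ => -(1 / (2 * Real.pi)) * w) (cocompact ℝ) (cocompact ℝ) :=
    (Homeomorph.mulLeft₀ _ hne).isClosedEmbedding.tendsto_cocompact
  have h3 := (h1.comp h2).const_smul (if a ≤ b then (1 : ℝ) else -1)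
  rw [smul_zero] at h3
  refine h3.congr fun w => ?_
  rw [intervalIntegral.intervalIntegral_eq_integral_uIoc]
  congr 1
  rw [← integral_indicator measurableSet_uIoc]
  refine integral_congr_ae (Eventually.of_forall fun u => ?_)
  simp only [Set.indicator]
  split_ifs
  · rw [Circle.smul_def, Real.fourierChar_apply, smul_eq_mul]
    congr 2
    have := Real.pi_ne_zero
    push_cast
    field_simp
  · simp

/-- Since `sin (π(s-k)) = (-1)^k sin (πs)`, this is a Dirichlet kernel shifted by `π`, so the sum
telescopes. -/
theorem two_cos_half_mul_sum_sin_mul_exp (N : ℕ) (s u : ℝ) :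
    2 * Complex.cos (u / 2) * ∑ k ∈ Finset.Icc (-(N : ℤ)) N,
        (Real.sin (Real.pi * (s - k)) : ℂ) * Complex.exp (Complex.I * k * u) =
      (-1) ^ N * Real.sin (Real.pi * s) *
        (Complex.exp (Complex.I * (N + 1 / 2 : ℝ) * u) +
          Complex.exp (Complex.I * (-(N + 1 / 2) : ℝ) * u)) := by
  rw [sum_Icc_neg_eq]
  have hcos : 2 * Complex.cos (u / 2) =
      Complex.exp (Complex.I * u / 2) + Complex.exp (-(Complex.I * u / 2)) := by
    rw [Complex.two_cos]
    congr 2 <;> ring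
  rw [hcos]
  induction N with
  | zero =>
    simp only [Finset.range_zero, Finset.sum_empty, add_zero, Int.cast_zero, sub_zero, mul_zero,
      zero_mul, Complex.exp_zero, mul_one, pow_zero, one_mul, Nat.cast_zero, zero_add]
    rw [mul_comm]
    congr 3 <;> push_cast <;> ring
  | succ N ih =>
    rw [Finset.sum_range_succ, ← add_assoc, mul_add, ih]
    have e1 : Real.sin (Real.pi * (s - ((N + 1 : ℤ) : ℝ))) =
        (-1) ^ (N + 1) * Real.sin (Real.pi * s) := by
      have := Real.sin_sub_nat_mul_pi (Real.pi * s) (N + 1)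
      rw [← this]
      push_cast
      ring_nf
    have e2 : Real.sin (Real.pi * (s - ((-(N + 1) : ℤ) : ℝ))) =
        (-1) ^ (N + 1) * Real.sin (Real.pi * s) := by
      have := Real.sin_add_nat_mul_pi (Real.pi * s) (N + 1)
      rw [← this]
      push_cast
      ring_nf
    rw [e1, e2]
    have f1 : Complex.exp (Complex.I * ((N + 1 : ℤ) : ℂ) * u) =
        Complex.exp (Complex.I * (N + 1 / 2 : ℝ) * u) * Complex.exp (Complex.I * u / 2) := by
      rw [← Complex.exp_add]; congr 1; push_cast; ring
    have f2 : Complex.exp (Complex.I * ((-(N + 1) : ℤ) : ℂ) * u) =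
        Complex.exp (Complex.I * (-(N + 1 / 2) : ℝ) * u) * Complex.exp (-(Complex.I * u / 2)) := by
      rw [← Complex.exp_add]; congr 1; push_cast; ring
    have f3 : Complex.exp (Complex.I * ((N + 1 : ℕ) + 1 / 2 : ℝ) * u) =
        Complex.exp (Complex.I * (N + 1 / 2 : ℝ) * u) * Complex.exp (Complex.I * u / 2) *
          Complex.exp (Complex.I * u / 2) := by
      rw [← Complex.exp_add, ← Complex.exp_add]; congr 1; push_cast; ring
    have f4 : Complex.exp (Complex.I * (-((N + 1 : ℕ) + 1 / 2) : ℝ) * u) =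
        Complex.exp (Complex.I * (-(N + 1 / 2) : ℝ) * u) * Complex.exp (-(Complex.I * u / 2)) *
          Complex.exp (-(Complex.I * u / 2)) := by
      rw [← Complex.exp_add, ← Complex.exp_add]; congr 1; push_cast; ring
    have f5 : Complex.exp (Complex.I * u / 2) * Complex.exp (-(Complex.I * u / 2)) = 1 := by
      rw [← Complex.exp_add]; simp
    rw [f1, f2, f3, f4]
    push_cast
    linear_combination ((-1) ^ (N + 1) * Complex.sin (Real.pi * s) *
      (Complex.exp (Complex.I * (N + 1 / 2) * u) +
        Complex.exp (Complex.I * (-(N + 1 / 2)) * u))) * f5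

/-- Differentiation brings down `i(k - s)`, cancelling the denominators of the `sinc` factors. -/
theorem hasDerivAt_exp_mul_cardinalSum (N : ℕ) (s u : ℝ) :
    HasDerivAt (fun u : ℝ => Complex.exp (-(Complex.I * s * u)) * cardinalSum N s u)
      (-(Complex.I / Real.pi) * (Complex.exp (-(Complex.I * s * u)) *
        ∑ k ∈ Finset.Icc (-(N : ℤ)) N,
          (Real.sin (Real.pi * (s - k)) : ℂ) * Complex.exp (Complex.I * k * u))) u := by
  unfold cardinalSum
  simp_rw [Finset.mul_sum]
  refine HasDerivAt.fun_sum fun k _ => ?_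
  have h1 : HasDerivAt (fun u : ℝ => Complex.exp (-(Complex.I * s * u)))
      (Complex.exp (-(Complex.I * s * u)) * (-(Complex.I * s * 1))) u :=
    ((Complex.ofRealCLM.hasDerivAt (x := u)).const_mul (Complex.I * s)).neg.cexp
  have h2 : HasDerivAt (fun u : ℝ => Complex.exp (Complex.I * k * u))
      (Complex.exp (Complex.I * k * u) * (Complex.I * k * 1)) u :=
    ((Complex.ofRealCLM.hasDerivAt (x := u)).const_mul (Complex.I * k)).cexp
  refine (h1.mul (h2.const_mul (Real.sinc (Real.pi * (s - k)) : ℂ))).congr_deriv ?_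
  rw [← mul_sinc]
  have := Complex.ofReal_ne_zero.2 Real.pi_ne_zero
  push_cast
  field_simp
  ring

/-- The difference is the integral from `0` to `θ` of the derivative, an oscillation of frequency
`±(N + 1/2)` against a weight with `cos (u/2)` in the denominator. The weight is continuous as `|θ|
< π`, so Riemann–Lebesgue applies. -/
theorem tendsto_exp_mul_cardinalSum_sub (s : ℝ) {θ : ℝ} (hθ : |θ| < Real.pi) :
    Tendsto (fun N : ℕ => Complex.exp (-(Complex.I * s * θ)) * cardinalSum N s θ -
      cardinalSum N s 0) atTop (𝓝 0) := by
  set h : ℝ → ℂ := fun u => Complex.exp (-(Complex.I * s * u)) / (2 * Complex.cos (u / 2)) with hh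
  have hcos : ∀ u ∈ Set.uIcc 0 θ, Complex.cos ((u : ℂ) / 2) ≠ 0 := by
    intro u hu
    have hu' : |u| ≤ |θ| := by
      simpa using Set.abs_sub_left_of_mem_uIcc hu
    have hu2 := abs_lt.1 (hu'.trans_lt hθ)
    have : 0 < Real.cos (u / 2) :=
      Real.cos_pos_of_mem_Ioo ⟨by linarith, by linarith⟩
    have h2 : Complex.cos ((u : ℂ) / 2) = (Real.cos (u / 2) : ℂ) := by push_cast; rfl
    rw [h2]
    exact Complex.ofReal_ne_zero.2 this.ne'
  have hcont : ContinuousOn h (Set.uIcc 0 θ) := by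
    refine ContinuousOn.div (by fun_prop) (by fun_prop) fun u hu => ?_
    exact mul_ne_zero two_ne_zero (hcos u hu)
  set R : ℝ → ℂ := fun w => ∫ u in (0 : ℝ)..θ, Complex.exp (Complex.I * w * u) * h u with hR
  have hRt : Tendsto R (cocompact ℝ) (𝓝 0) := tendsto_intervalIntegral_exp_mul_cocompact 0 θ h
  have hint : ∀ w : ℝ, IntervalIntegrable (fun u : ℝ => Complex.exp (Complex.I * w * u) * h u)
      volume 0 θ := fun w => ContinuousOn.intervalIntegrable
        (ContinuousOn.mul (by fun_prop) hcont)
  have hkey : ∀ N : ℕ, Complex.exp (-(Complex.I * s * θ)) * cardinalSum N s θ -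
      cardinalSum N s 0 = -(Complex.I / Real.pi) * ((-1) ^ N * Real.sin (Real.pi * s)) *
        (R (N + 1 / 2) + R (-(N + 1 / 2))) := by
    intro N
    have hFTC := intervalIntegral.integral_eq_sub_of_hasDerivAt (a := 0) (b := θ)
      (fun u _ => hasDerivAt_exp_mul_cardinalSum N s u)
      (Continuous.intervalIntegrable (by fun_prop) _ _)
    simp only [Complex.ofReal_zero, mul_zero, neg_zero, Complex.exp_zero, one_mul] at hFTC
    rw [← hFTC, hR]
    simp only
    rw [← intervalIntegral.integral_add (hint _) (hint _), ← intervalIntegral.integral_const_mul]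
    refine intervalIntegral.integral_congr fun u hu => ?_
    have hD := two_cos_half_mul_sum_sin_mul_exp N s u
    have hc := hcos u hu
    simp only [hh]
    rw [← add_mul]
    have hD2 : ∑ k ∈ Finset.Icc (-(N : ℤ)) N,
        (Real.sin (Real.pi * (s - k)) : ℂ) * Complex.exp (Complex.I * k * u) =
        (-1) ^ N * Real.sin (Real.pi * s) *
        (Complex.exp (Complex.I * (N + 1 / 2 : ℝ) * u) +
          Complex.exp (Complex.I * (-(N + 1 / 2) : ℝ) * u)) / (2 * Complex.cos (u / 2)) := by
      rw [eq_div_iff (mul_ne_zero two_ne_zero hc), ← hD]; ring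
    rw [hD2]
    ring
  have hN : Tendsto (fun N : ℕ => ((N : ℝ) + 1 / 2)) atTop atTop :=
    tendsto_atTop_add_const_right _ _ tendsto_natCast_atTop_atTop
  have ht : Tendsto (fun N : ℕ => R (N + 1 / 2) + R (-(N + 1 / 2))) atTop (𝓝 0) := by
    have h1 := hRt.comp (hN.mono_right atTop_le_cocompact)
    have h2 := hRt.comp ((tendsto_neg_atTop_atBot.comp hN).mono_right atBot_le_cocompact)
    simpa using h1.add h2
  refine squeeze_zero_norm (a := fun N : ℕ =>
    |Real.sin (Real.pi * s)| / Real.pi * ‖R (N + 1 / 2) + R (-(N + 1 / 2))‖) (fun N => ?_) ?_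
  · rw [hkey]
    refine le_of_eq ?_
    rw [norm_mul, norm_mul, norm_mul, norm_neg, norm_div, Complex.norm_I, Complex.norm_real,
      Complex.norm_real, norm_pow, norm_neg, norm_one, one_pow, Real.norm_eq_abs,
      Real.norm_eq_abs, abs_of_pos Real.pi_pos]
    ring
  · simpa using ht.norm.const_mul (|Real.sin (Real.pi * s)| / Real.pi)

/-- The alternating series is twice its even-`q` part minus the full series. Both are cotangent
expansions, at `x/2` and at `x`, and `cot y - cot 2y = 1 / sin 2y`. -/
theorem tendsto_sum_neg_one_pow_cotTerm {x : ℂ} (hx : x ∈ Complex.integerComplement)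
    (hx2 : x / 2 ∈ Complex.integerComplement) :
    Tendsto (fun N : ℕ => ∑ j ∈ Finset.range N, (-1) ^ (j + 1) * cotTerm x j) atTop
      (𝓝 (Real.pi / Complex.sin (Real.pi * x) - 1 / x)) := by
  have h1 := (summable_cotTerm hx).hasSum_iff_tendsto_nat.2 (tendsto_logDeriv_euler_cot_sub hx)
  have h2 := (summable_cotTerm hx2).hasSum_iff_tendsto_nat.2 (tendsto_logDeriv_euler_cot_sub hx2)
  have h3 : HasSum (fun j : ℕ => (1 + (-1) ^ (j + 1)) * cotTerm x j)
      (0 + (Real.pi * Complex.cot (Real.pi * (x / 2)) - 1 / (x / 2))) := by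
    refine HasSum.even_add_odd ?_ ?_
    · have : (fun k : ℕ => (1 + (-1) ^ (2 * k + 1)) * cotTerm x (2 * k)) = fun _ => 0 := by
        funext k
        rw [pow_succ, pow_mul]
        simp
      rw [this]
      exact hasSum_zero
    · convert h2 using 2 with k
      rw [show 2 * k + 1 + 1 = 2 * (k + 1) by ring, pow_mul]
      have e1 : x - ((2 * k + 1 : ℕ) + 1) = 2 * (x / 2 - (k + 1)) := by push_cast; ring
      have e2 : x + ((2 * k + 1 : ℕ) + 1) = 2 * (x / 2 + (k + 1)) := by push_cast; ring
      simp only [cotTerm]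
      rw [e1, e2, neg_one_sq, one_pow]
      simp only [one_div, mul_inv]
      ring
  have h4 := (h3.sub h1).tendsto_sum_nat
  have hs : Complex.sin (Real.pi * x) ≠ 0 := sin_pi_mul_ne_zero hx
  have hs2 : Complex.sin (Real.pi * (x / 2)) ≠ 0 := sin_pi_mul_ne_zero hx2
  have hx0 : x ≠ 0 := Complex.integerComplement.ne_zero hx
  have hval : 0 + (Real.pi * Complex.cot (Real.pi * (x / 2)) - 1 / (x / 2)) -
      (Real.pi * Complex.cot (Real.pi * x) - 1 / x) =
      Real.pi / Complex.sin (Real.pi * x) - 1 / x := by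
    have hd : Complex.cot (Real.pi * (x / 2)) - Complex.cot (Real.pi * x) =
        1 / Complex.sin (Real.pi * x) := by
      have e : (Real.pi : ℂ) * x = 2 * (Real.pi * (x / 2)) := by ring
      rw [e] at hs ⊢
      generalize (Real.pi : ℂ) * (x / 2) = y at *
      rw [Complex.cot_eq_cos_div_sin, Complex.cot_eq_cos_div_sin, div_sub_div _ _ hs2 hs,
        div_eq_div_iff (mul_ne_zero hs2 hs) hs]
      rw [Complex.sin_two_mul, Complex.cos_two_mul]
      ring
    have : (Real.pi : ℂ) / Complex.sin (Real.pi * x) =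
        Real.pi * (1 / Complex.sin (Real.pi * x)) := by ring
    rw [this, ← hd]
    field_simp
    ring
  rw [hval] at h4
  refine h4.congr fun N => Finset.sum_congr rfl fun j _ => ?_
  ring

theorem cardinalSum_of_int {N : ℕ} {m : ℤ} (hm : m ∈ Finset.Icc (-(N : ℤ)) N) (θ : ℝ) :
    cardinalSum N m θ = Complex.exp (Complex.I * m * θ) := by
  unfold cardinalSum
  rw [Finset.sum_eq_single_of_mem m hm]
  · simp
  · intro k _ hk
    have : Real.sinc (Real.pi * (m - k)) = 0 := by
      have hne : Real.pi * ((m : ℝ) - k) ≠ 0 :=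
        mul_ne_zero Real.pi_ne_zero (sub_ne_zero.2 (by exact_mod_cast hk.symm))
      rw [Real.sinc_of_ne_zero hne, mul_comm, ← Int.cast_sub, Real.sin_int_mul_pi, zero_div]
    rw [this]
    simp

/-- For integer `s` the sum is eventually exactly `1`; otherwise this is the partial fraction
expansion of `π / sin (πs)`. -/
theorem tendsto_cardinalSum_zero (s : ℝ) :
    Tendsto (fun N : ℕ => cardinalSum N s 0) atTop (𝓝 1) := by
  by_cases hs : ∃ m : ℤ, (m : ℝ) = s
  · obtain ⟨m, rfl⟩ := hs
    refine tendsto_const_nhds.congr' ?_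
    filter_upwards [eventually_ge_atTop m.natAbs] with N hN
    rw [cardinalSum_of_int (by rw [Finset.mem_Icc]; omega)]
    simp
  · have hx : (s : ℂ) ∈ Complex.integerComplement := by
      rintro ⟨m, hm⟩
      exact hs ⟨m, by exact_mod_cast hm⟩
    have hx2 : (s : ℂ) / 2 ∈ Complex.integerComplement := by
      rintro ⟨m, hm⟩
      refine hs ⟨2 * m, ?_⟩
      have : (s : ℂ) = ((2 * m : ℤ) : ℂ) := by push_cast; rw [hm]; ring
      exact_mod_cast this.symm
    have hs0 : s ≠ 0 := fun h => hs ⟨0, by simp [h]⟩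
    have hsin : Complex.sin (Real.pi * s) ≠ 0 := sin_pi_mul_ne_zero hx
    have hpi := Complex.ofReal_ne_zero.2 Real.pi_ne_zero
    have h1 := ((tendsto_sum_neg_one_pow_cotTerm hx hx2).const_mul
      (Complex.sin (Real.pi * s) / Real.pi)).const_add
      (Real.sinc (Real.pi * s) : ℂ)
    have hval : (Real.sinc (Real.pi * s) : ℂ) + Complex.sin (Real.pi * s) / Real.pi *
        (Real.pi / Complex.sin (Real.pi * s) - 1 / s) = 1 := by
      rw [Real.sinc_of_ne_zero (mul_ne_zero Real.pi_ne_zero hs0)]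
      have := Complex.ofReal_ne_zero.2 hs0
      push_cast
      field_simp
      ring
    rw [hval] at h1
    refine h1.congr fun N => ?_
    unfold cardinalSum
    rw [sum_Icc_neg_eq, Finset.mul_sum]
    congr 1
    · simp
    · refine Finset.sum_congr rfl fun j _ => ?_
      have n1 : s - (j + 1) ≠ 0 := fun h => hs ⟨j + 1, by push_cast; linarith⟩
      have n2 : s + (j + 1) ≠ 0 := fun h => hs ⟨-(j + 1), by push_cast; linarith⟩
      have e1 : Real.sin (Real.pi * (s - (j + 1))) = (-1) ^ (j + 1) * Real.sin (Real.pi * s) := by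
        rw [← Real.sin_sub_nat_mul_pi]; push_cast; ring_nf
      have e2 : Real.sin (Real.pi * (s + (j + 1))) = (-1) ^ (j + 1) * Real.sin (Real.pi * s) := by
        rw [← Real.sin_add_nat_mul_pi]; push_cast; ring_nf
      have c1 : (s : ℂ) - (j + 1) ≠ 0 := by exact_mod_cast Complex.ofReal_ne_zero.2 n1
      have c2 : (s : ℂ) + (j + 1) ≠ 0 := by exact_mod_cast Complex.ofReal_ne_zero.2 n2
      have n3 : s - ((-(j + 1) : ℤ) : ℝ) = s + (j + 1) := by push_cast; ring
      have n4 : s - ((j + 1 : ℤ) : ℝ) = s - (j + 1) := by push_cast; ring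
      rw [n3, n4, Real.sinc_of_ne_zero (mul_ne_zero Real.pi_ne_zero n1),
        Real.sinc_of_ne_zero (mul_ne_zero Real.pi_ne_zero n2), e1, e2]
      simp only [cotTerm, Complex.ofReal_zero, mul_zero, Complex.exp_zero, mul_one]
      push_cast
      field_simp

/-- Pointwise convergence of the cardinal series on `(-π, π)`. -/
theorem tendsto_cardinalSum (s : ℝ) {θ : ℝ} (hθ : |θ| < Real.pi) :
    Tendsto (fun N : ℕ => cardinalSum N s θ) atTop (𝓝 (Complex.exp (Complex.I * s * θ))) := by
  have h := ((tendsto_exp_mul_cardinalSum_sub s hθ).add (tendsto_cardinalSum_zero s)).const_mul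
    (Complex.exp (Complex.I * s * θ))
  rw [zero_add, mul_one] at h
  refine h.congr fun N => ?_
  rw [sub_add_cancel, ← mul_assoc, ← Complex.exp_add]
  simp


/-! ### Truncation error inside the band. -/

/-- Abel's inequality. -/
theorem abs_sum_mul_le_of_antitone {c b : ℕ → ℝ} {K : ℝ} (hc : Antitone c) (hc0 : ∀ j, 0 ≤ c j)
    (hb : ∀ m, |∑ j ∈ Finset.range m, b j| ≤ K) (M : ℕ) :
    |∑ j ∈ Finset.range M, c j * b j| ≤ K * c 0 := by
  have hK : 0 ≤ K := (abs_nonneg _).trans (hb 0)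
  -- Subtracting the boundary term makes the induction close; restoring it costs at most `K * c M`.
  have hrec : ∀ M, |∑ j ∈ Finset.range M, c j * b j - c M * ∑ j ∈ Finset.range M, b j| ≤
      K * (c 0 - c M) := by
    intro M
    induction M with
    | zero => simp
    | succ M ih =>
      have : ∑ j ∈ Finset.range (M + 1), c j * b j -
          c (M + 1) * ∑ j ∈ Finset.range (M + 1), b j =
          (∑ j ∈ Finset.range M, c j * b j - c M * ∑ j ∈ Finset.range M, b j) +
          (c M - c (M + 1)) * ∑ j ∈ Finset.range (M + 1), b j := by
        rw [Finset.sum_range_succ, Finset.sum_range_succ]; ring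
      rw [this]
      refine (abs_add_le _ _).trans ?_
      have h0 : 0 ≤ c M - c (M + 1) := sub_nonneg.2 (hc M.le_succ)
      rw [abs_mul, abs_of_nonneg h0]
      nlinarith [mul_le_mul_of_nonneg_left (hb (M + 1)) h0]
  have h1 := hrec M
  have h2 : |c M * ∑ j ∈ Finset.range M, b j| ≤ c M * K := by
    rw [abs_mul, abs_of_nonneg (hc0 M)]
    exact mul_le_mul_of_nonneg_left (hb M) (hc0 M)
  have h3 := abs_add_le (∑ j ∈ Finset.range M, c j * b j - c M * ∑ j ∈ Finset.range M, b j)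
    (c M * ∑ j ∈ Finset.range M, b j)
  rw [sub_add_cancel] at h3
  linarith

theorem two_sin_half_mul_sum_sin (n m : ℕ) (x : ℝ) :
    2 * Real.sin (x / 2) * ∑ j ∈ Finset.range m, Real.sin ((n + j + 1 : ℕ) * x) =
      Real.cos ((n + 1 / 2 : ℝ) * x) - Real.cos ((n + m + 1 / 2 : ℝ) * x) := by
  induction m with
  | zero => simp
  | succ m ih =>
    rw [Finset.sum_range_succ, mul_add, ih]
    have h1 : (n + (m + 1 : ℕ) + 1 / 2 : ℝ) * x = (n + m + 1 : ℕ) * x + x / 2 := by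
      push_cast; ring
    have h2 : (n + m + 1 / 2 : ℝ) * x = (n + m + 1 : ℕ) * x - x / 2 := by push_cast; ring
    rw [h1, h2, Real.cos_add, Real.cos_sub]
    ring

theorem abs_sum_sin_le (n m : ℕ) {x κ : ℝ} (hκ : 0 < κ) (hx : κ ≤ Real.sin (x / 2)) :
    |∑ j ∈ Finset.range m, Real.sin ((n + j + 1 : ℕ) * x)| ≤ 1 / κ := by
  have h := two_sin_half_mul_sum_sin n m x
  have h1 := Real.abs_cos_le_one ((n + 1 / 2 : ℝ) * x)
  have h2 := Real.abs_cos_le_one ((n + m + 1 / 2 : ℝ) * x)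
  have h3 := abs_sub (Real.cos ((n + 1 / 2 : ℝ) * x)) (Real.cos ((n + m + 1 / 2 : ℝ) * x))
  rw [← h, abs_mul, abs_of_pos (by linarith : 0 < 2 * Real.sin (x / 2))] at h3
  rw [le_div_iff₀ hκ]
  nlinarith [abs_nonneg (∑ j ∈ Finset.range m, Real.sin ((n + j + 1 : ℕ) * x))]

theorem sum_one_div_sq_le {n : ℕ} (hn : 1 ≤ n) (m : ℕ) :
    ∑ j ∈ Finset.range m, 1 / ((n + j + 1 : ℕ) : ℝ) ^ 2 ≤ 1 / (n : ℝ) := by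
  have hn0 : (0 : ℝ) < n := by exact_mod_cast hn
  suffices h : ∑ j ∈ Finset.range m, 1 / ((n + j + 1 : ℕ) : ℝ) ^ 2 ≤
      1 / (n : ℝ) - 1 / ((n + m : ℕ) : ℝ) by
    have : 0 ≤ 1 / ((n + m : ℕ) : ℝ) := by positivity
    linarith
  induction m with
  | zero => simp
  | succ m ih =>
    rw [Finset.sum_range_succ]
    have h1 : 1 / ((n + m + 1 : ℕ) : ℝ) ^ 2 ≤
        1 / ((n + m : ℕ) : ℝ) - 1 / ((n + (m + 1) : ℕ) : ℝ) := by
      push_cast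
      rw [← add_assoc]
      have hp : (0 : ℝ) < n + m := by positivity
      generalize (n + m : ℝ) = y at *
      rw [div_sub_div _ _ (by positivity) (by positivity),
        div_le_div_iff₀ (by positivity) (by positivity)]
      nlinarith
    linarith

/-- For `q > n`, `q² - s² ≥ (1-z)q²`. The cosine part is then bounded through `∑ 1/q² ≤ 1/n`. For
the sine part Abel's inequality applies: the coefficients decrease, and the sums of `sin (q(θ+π))`
are at most `1/κ` because `sin ((θ+π)/2) = cos (θ/2) ≥ κ`. The bound is independent of `M`. -/
theorem norm_cardinalSum_add_sub_le {n : ℕ} (hn : 1 ≤ n) {s a z κ θ : ℝ} (hs : 0 ≤ s)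
    (hsa : s ≤ a) (hz : a ^ 2 = z * n ^ 2) (hz0 : 0 ≤ z) (hz1 : z < 1) (hκ : 0 < κ)
    (hθ : κ ≤ Real.cos (θ / 2)) (M : ℕ) :
    ‖cardinalSum (n + M) s θ - cardinalSum n s θ‖ ≤
      2 / (Real.pi * n * (1 - z)) * (a + 1 / κ) := by
  have hn0 : (0 : ℝ) < n := by exact_mod_cast hn
  have ha : 0 ≤ a := hs.trans hsa
  have hz1' : 0 < 1 - z := by linarith
  have hsz : s ^ 2 ≤ z * n ^ 2 := by rw [← hz]; gcongr
  have hsn : s < n := lt_of_pow_lt_pow_left₀ 2 hn0.le (by nlinarith [pow_pos hn0 2])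
  have hq : ∀ j : ℕ, (1 - z) * ((n + j + 1 : ℕ) : ℝ) ^ 2 ≤ ((n + j + 1 : ℕ) : ℝ) ^ 2 - s ^ 2 := by
    intro j
    have : (n : ℝ) ^ 2 ≤ ((n + j + 1 : ℕ) : ℝ) ^ 2 := by
      gcongr
      omega
    nlinarith
  have hqpos : ∀ j : ℕ, 0 < ((n + j + 1 : ℕ) : ℝ) ^ 2 - s ^ 2 := fun j =>
    lt_of_lt_of_le (by positivity) (hq j)
  set φ := θ + Real.pi with hφ
  have hdiff : cardinalSum (n + M) s θ - cardinalSum n s θ =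
      ((-(Real.sin (Real.pi * s) / Real.pi) * ∑ j ∈ Finset.range M,
        2 * s / (((n + j + 1 : ℕ) : ℝ) ^ 2 - s ^ 2) * Real.cos ((n + j + 1 : ℕ) * φ) : ℝ) : ℂ) +
      ((-(Real.sin (Real.pi * s) / Real.pi) * ∑ j ∈ Finset.range M,
        2 * (n + j + 1 : ℕ) / (((n + j + 1 : ℕ) : ℝ) ^ 2 - s ^ 2) *
          Real.sin ((n + j + 1 : ℕ) * φ) : ℝ) : ℂ) * Complex.I := by
    unfold cardinalSum
    rw [sum_Icc_neg_eq, sum_Icc_neg_eq, Finset.sum_range_add, ← add_assoc, add_sub_cancel_left,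
      Finset.mul_sum, Finset.mul_sum, Complex.ofReal_sum, Complex.ofReal_sum, Finset.sum_mul,
      ← Finset.sum_add_distrib]
    refine Finset.sum_congr rfl fun j _ => ?_
    have hp := hqpos j
    have h1 : s - (n + j + 1 : ℕ) ≠ 0 := by
      push_cast; have : (0 : ℝ) ≤ j := Nat.cast_nonneg j; linarith
    have h2 : s + (n + j + 1 : ℕ) ≠ 0 := by positivity
    have h := sinc_mul_exp_pair s θ (n + j + 1) h1 h2
    have hneg : s ^ 2 - ((n + j + 1 : ℕ) : ℝ) ^ 2 = -(((n + j + 1 : ℕ) : ℝ) ^ 2 - s ^ 2) := by ring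
    refine Eq.trans ?_ (h.trans ?_)
    · push_cast
      congr 2
      · congr 3
        ring
      · congr 1
        ring
    · rw [hneg]
      simp only [div_neg, neg_mul, mul_neg, hφ]
  have hC : |∑ j ∈ Finset.range M, 2 * s / (((n + j + 1 : ℕ) : ℝ) ^ 2 - s ^ 2) *
      Real.cos ((n + j + 1 : ℕ) * φ)| ≤ 2 / (n * (1 - z)) * a := by
    calc _ ≤ ∑ j ∈ Finset.range M, 2 * a / (1 - z) * (1 / ((n + j + 1 : ℕ) : ℝ) ^ 2) := by
          refine (Finset.abs_sum_le_sum_abs _ _).trans (Finset.sum_le_sum fun j _ => ?_)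
          rw [abs_mul]
          refine (mul_le_of_le_one_right (abs_nonneg _) (Real.abs_cos_le_one _)).trans ?_
          rw [abs_of_nonneg (div_nonneg (by positivity) (hqpos j).le), div_mul_div_comm, mul_one]
          exact div_le_div₀ (by positivity) (by linarith) (by positivity) (hq j)
      _ ≤ 2 * a / (1 - z) * (1 / n) := by
          rw [← Finset.mul_sum]
          exact mul_le_mul_of_nonneg_left (sum_one_div_sq_le hn M) (by positivity)
      _ = _ := by field_simp
  have hS : |∑ j ∈ Finset.range M, 2 * (n + j + 1 : ℕ) / (((n + j + 1 : ℕ) : ℝ) ^ 2 - s ^ 2) *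
      Real.sin ((n + j + 1 : ℕ) * φ)| ≤ 2 / (n * (1 - z)) * (1 / κ) := by
    have hsin : κ ≤ Real.sin (φ / 2) := by
      rw [hφ, add_div, Real.sin_add_pi_div_two]; exact hθ
    have hanti : Antitone fun j : ℕ =>
        2 * ((n + j + 1 : ℕ) : ℝ) / (((n + j + 1 : ℕ) : ℝ) ^ 2 - s ^ 2) := by
      refine antitone_nat_of_succ_le fun j => ?_
      have h1 := hqpos j
      have h2 := hqpos (j + 1)
      have h0 : (0 : ℝ) ≤ (n + j + 1 : ℕ) := Nat.cast_nonneg _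
      rw [div_le_div_iff₀ h2 h1]
      have e : ((n + (j + 1) + 1 : ℕ) : ℝ) = (n + j + 1 : ℕ) + 1 := by push_cast; ring
      rw [e] at *
      generalize ((n + j + 1 : ℕ) : ℝ) = q at *
      nlinarith [sq_nonneg s]
    have hA := abs_sum_mul_le_of_antitone hanti
      (fun j => div_nonneg (by positivity) (hqpos j).le)
      (fun m => abs_sum_sin_le n m hκ hsin) M
    refine hA.trans ?_
    rw [mul_comm]
    refine mul_le_mul_of_nonneg_right ?_ (by positivity)
    have h0 := hq 0
    have hp0 := hqpos 0
    rw [add_zero] at *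
    have hge : (n : ℝ) ≤ (n + 1 : ℕ) := by push_cast; linarith
    have hq0 : (0 : ℝ) ≤ (n + 1 : ℕ) := Nat.cast_nonneg _
    generalize ((n + 1 : ℕ) : ℝ) = q at *
    rw [div_le_div_iff₀ hp0 (by positivity)]
    nlinarith [mul_le_mul_of_nonneg_left hge (mul_nonneg hz1'.le hq0)]
  rw [hdiff]
  refine (norm_add_le _ _).trans ?_
  rw [norm_mul, Complex.norm_I, mul_one, Complex.norm_real, Complex.norm_real, Real.norm_eq_abs,
    Real.norm_eq_abs, abs_mul, abs_mul, ← mul_add, abs_neg, abs_div, abs_of_pos Real.pi_pos]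
  have hsin1 : |Real.sin (Real.pi * s)| / Real.pi ≤ 1 / Real.pi := by
    gcongr
    exact Real.abs_sin_le_one _
  refine (mul_le_mul hsin1 (add_le_add hC hS) (by positivity) (by positivity)).trans_eq ?_
  field_simp

/-- The truncation error of the cardinal series inside the band. -/
theorem norm_exp_sub_cardinalSum_le {n : ℕ} (hn : 1 ≤ n) {s a z r θ : ℝ} (hs : 0 ≤ s)
    (hsa : s ≤ a) (hz : a ^ 2 = z * n ^ 2) (hz0 : 0 ≤ z) (hz1 : z < 1) (hr : r < 1)
    (hθ : |θ| ≤ Real.pi * r) :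
    ‖Complex.exp (Complex.I * s * θ) - cardinalSum n s θ‖ ≤
      2 / (Real.pi * n * (1 - z)) * (a + 1 / (1 - r)) := by
  have hpi := Real.pi_pos
  have hθ' : |θ| < Real.pi := hθ.trans_lt (by nlinarith)
  have hκ : 1 - r ≤ Real.cos (θ / 2) := by
    rw [← Real.cos_abs, abs_div, abs_two]
    -- The chord bound `cos x ≥ 1 - 2x/π` on `[0, π/2]` yields `κ = 1 - r`.
    refine le_trans ?_ (Real.one_sub_mul_le_cos (by positivity) (by linarith))
    have : 2 / Real.pi * (|θ| / 2) = |θ| / Real.pi := by field_simp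
    rw [this]
    have : |θ| / Real.pi ≤ r := by rw [div_le_iff₀ hpi]; linarith
    linarith
  have ht := ((tendsto_cardinalSum s hθ').comp (tendsto_add_atTop_nat n)).sub_const
    (cardinalSum n s θ)
  refine le_of_tendsto' ht.norm fun M => ?_
  simp only [Function.comp_apply]
  rw [add_comm M n]
  exact norm_cardinalSum_add_sub_le hn hs hsa hz hz0 hz1 (by linarith) hκ M

/-! ### Second moments through the spectral measure. -/

theorem integral_mul_eq_covariance {Ω : Type*} [MeasurableSpace Ω] {P : Measure Ω}
    {X : ℝ → Ω → ℝ} (hX : IsStationaryProcess P X) (u v : ℝ) :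
    ∫ x, X u x * X v x ∂P = covariance P X (u - v) := by
  rw [covariance, ← hX.stationary v 0 (u - v), add_sub_cancel]

/-- The spectral representation of the second moment of a linear combination. -/
theorem integral_sq_sum_eq {Ω : Type*} [MeasurableSpace Ω] {P : Measure Ω}
    {X : ℝ → Ω → ℝ} (hX : IsStationaryProcess P X) {F : Measure ℝ} [IsFiniteMeasure F]
    (hF : IsSpectralMeasure P X F) {ι : Type*} (S : Finset ι) (c τ : ι → ℝ) :
    ∫ x, (∑ i ∈ S, c i * X (τ i) x) ^ 2 ∂P =
      ∫ l, ‖∑ i ∈ S, (c i : ℂ) * Complex.exp (Complex.I * τ i * l)‖ ^ 2 ∂F := by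
  -- Both sides expand to the same quadratic form in the covariances `B(τ i - τ j)`, so no
  -- stochastic integral is needed.
  have hL : ∫ x, (∑ i ∈ S, c i * X (τ i) x) ^ 2 ∂P =
      ∑ i ∈ S, ∑ j ∈ S, c i * c j * covariance P X (τ i - τ j) := by
    simp_rw [sq, Finset.sum_mul_sum]
    have hint : ∀ i j, Integrable (fun x => c i * X (τ i) x * (c j * X (τ j) x)) P := by
      intro i j
      have := ((hX.memLp (τ i)).integrable_mul (hX.memLp (τ j))).const_mul (c i * c j)
      refine this.congr (Eventually.of_forall fun x => ?_)
      simp only [Pi.mul_apply]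
      ring
    rw [integral_finsetSum _ fun i _ => integrable_finsetSum _ fun j _ => hint i j]
    refine Finset.sum_congr rfl fun i _ => ?_
    rw [integral_finsetSum _ fun j _ => hint i j]
    refine Finset.sum_congr rfl fun j _ => ?_
    rw [← integral_mul_eq_covariance hX, ← integral_const_mul]
    congr 1
    funext x
    ring
  have hexp : ∀ t : ℝ, Integrable (fun l : ℝ => Complex.exp (Complex.I * t * l)) F := by
    intro t
    refine Integrable.of_bound (C := 1) (by fun_prop) (Eventually.of_forall fun l => ?_)
    rw [show Complex.I * t * l = ((t * l : ℝ) : ℂ) * Complex.I by push_cast; ring,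
      Complex.norm_exp_ofReal_mul_I]
  have hR : ((∫ l, ‖∑ i ∈ S, (c i : ℂ) * Complex.exp (Complex.I * τ i * l)‖ ^ 2 ∂F : ℝ) : ℂ) =
      ∑ i ∈ S, ∑ j ∈ S, (c i : ℂ) * c j * covariance P X (τ i - τ j) := by
    rw [← integral_complex_ofReal]
    have hpt : ∀ l : ℝ,
        ((‖∑ i ∈ S, (c i : ℂ) * Complex.exp (Complex.I * τ i * l)‖ ^ 2 : ℝ) : ℂ) =
        ∑ i ∈ S, ∑ j ∈ S, (c i : ℂ) * c j *
          Complex.exp (Complex.I * ((τ i - τ j : ℝ) : ℂ) * l) := by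
      intro l
      push_cast
      rw [← Complex.mul_conj', map_sum, Finset.sum_mul_sum]
      refine Finset.sum_congr rfl fun i _ => Finset.sum_congr rfl fun j _ => ?_
      rw [map_mul, Complex.conj_ofReal, ← Complex.exp_conj, map_mul, map_mul, Complex.conj_I,
        Complex.conj_ofReal, Complex.conj_ofReal, mul_mul_mul_comm, ← Complex.exp_add]
      congr 2
      ring
    simp_rw [hpt]
    have hint : ∀ i j, Integrable (fun l : ℝ => (c i : ℂ) * c j *
          Complex.exp (Complex.I * ((τ i - τ j : ℝ) : ℂ) * l)) F :=
      fun i j => (hexp _).const_mul _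
    rw [integral_finsetSum _ fun i _ => integrable_finsetSum _ fun j _ => hint i j]
    refine Finset.sum_congr rfl fun i _ => ?_
    rw [integral_finsetSum _ fun j _ => hint i j]
    refine Finset.sum_congr rfl fun j _ => ?_
    rw [integral_const_mul, hF]
  apply Complex.ofReal_injective
  rw [hR, hL]
  push_cast
  rfl

theorem covariance_zero_eq {Ω : Type*} [MeasurableSpace Ω] {P : Measure Ω}
    {X : ℝ → Ω → ℝ} {F : Measure ℝ} (hF : IsSpectralMeasure P X F) :
    covariance P X 0 = F.real Set.univ := by
  have := hF 0
  simp only [Complex.ofReal_zero, mul_zero, zero_mul, Complex.exp_zero, integral_const] at this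
  apply Complex.ofReal_injective
  rw [this]
  simp

theorem sinc_nodes_eq {ω : ℝ} (hω : ω ≠ 0) (t : ℝ) (k : ℤ) :
    Real.sinc (ω * (t - k * Real.pi / ω)) =
      Real.sinc (Real.pi * (ω * t / Real.pi - k)) := by
  have := Real.pi_ne_zero
  congr 1
  field_simp

/-- The spectral representation of the mean square error. -/
theorem integral_sq_error_eq {Ω : Type*} [MeasurableSpace Ω] {P : Measure Ω}
    {X : ℝ → Ω → ℝ} (hX : IsStationaryProcess P X) {F : Measure ℝ} [IsFiniteMeasure F]
    (hF : IsSpectralMeasure P X F) {ω : ℝ} (hω : ω ≠ 0) (n : ℕ) (t : ℝ) :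
    ∫ x, |X t x - truncated X ω n t x| ^ 2 ∂P =
      ∫ l : ℝ, ‖Complex.exp (Complex.I * t * l) -
        cardinalSum n (ω * t / Real.pi) (Real.pi * l / ω)‖ ^ 2 ∂F := by
  -- The index `none` carries `X t` with coefficient `1`; `some k` carries the sample at `kπ/ω` with
  -- coefficient `-sinc`.
  have h := integral_sq_sum_eq hX hF (Finset.insertNone (Finset.Icc (-(n : ℤ)) n))
    (fun o => o.elim 1 fun k => -Real.sinc (ω * (t - k * Real.pi / ω)))
    (fun o => o.elim t fun k => k * Real.pi / ω)
  simp only [Finset.sum_insertNone, Option.elim_none, Option.elim_some] at h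
  convert h using 3 with x l
  · rw [sq_abs, truncated]
    simp only [neg_mul, Finset.sum_neg_distrib]
    ring
  · rw [cardinalSum]
    simp only [Complex.ofReal_neg, neg_mul, Finset.sum_neg_distrib, Complex.ofReal_one, one_mul,
      ← sub_eq_add_neg]
    congr 3
    refine Finset.sum_congr rfl fun k _ => ?_
    rw [sinc_nodes_eq hω]
    congr 2
    push_cast
    ring

theorem norm_exp_I_mul (a b : ℝ) : ‖Complex.exp (Complex.I * a * b)‖ = 1 := by
  rw [show Complex.I * a * b = ((a * b : ℝ) : ℂ) * Complex.I by push_cast; ring,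
    Complex.norm_exp_ofReal_mul_I]

/-- Split the integral at `|l| = Λ`, enlarge the band to the whole line in the first mass, and use
`√(x² + y²) ≤ x + y`. -/
theorem sqrt_integral_sq_le {F : Measure ℝ} [IsFiniteMeasure F] {g : ℝ → ℝ} {Λ C D : ℝ}
    (hg : Measurable g) (hg0 : ∀ l, 0 ≤ g l) (hC : 0 ≤ C) (hD : 0 ≤ D)
    (h1 : ∀ l, |l| ≤ Λ → g l ≤ C) (h2 : ∀ l, g l ≤ D) :
    Real.sqrt (∫ l, g l ^ 2 ∂F) ≤
      C * Real.sqrt (F.real Set.univ) + D * Real.sqrt (F.real {l : ℝ | Λ < |l|}) := by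
  set A : Set ℝ := {l : ℝ | Λ < |l|}
  have hA : MeasurableSet A := measurableSet_lt measurable_const measurable_abs
  have hint : Integrable (fun l => g l ^ 2) F :=
    Integrable.of_bound (C := D ^ 2) (by fun_prop) (Eventually.of_forall fun l => by
      rw [Real.norm_of_nonneg (sq_nonneg _)]
      exact pow_le_pow_left₀ (hg0 l) (h2 l) 2)
  have hle : ∫ l, g l ^ 2 ∂F ≤ C ^ 2 * F.real Set.univ + D ^ 2 * F.real A := by
    rw [← integral_add_compl hA hint, add_comm]
    refine add_le_add ?_ ?_
    · have hm : F.real Aᶜ ≤ F.real Set.univ := measureReal_mono (Set.subset_univ _)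
      refine le_trans ?_ (mul_le_mul_of_nonneg_left hm (sq_nonneg C))
      refine (setIntegral_mono_on hint.integrableOn
        (integrableOn_const (measure_ne_top _ _)) hA.compl (g := fun _ => C ^ 2)
        fun l hl => ?_).trans_eq ?_
      · exact pow_le_pow_left₀ (hg0 l) (h1 l (not_lt.1 hl)) 2
      · rw [setIntegral_const, smul_eq_mul, mul_comm]
    · refine (setIntegral_mono_on hint.integrableOn
        (integrableOn_const (measure_ne_top _ _)) hA (g := fun _ => D ^ 2)
        fun l hl => ?_).trans_eq ?_
      · exact pow_le_pow_left₀ (hg0 l) (h2 l) 2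
      · rw [setIntegral_const, smul_eq_mul, mul_comm]
  refine (Real.sqrt_le_sqrt hle).trans (Real.sqrt_le_iff.2 ⟨by positivity, ?_⟩)
  have e1 := Real.sq_sqrt (measureReal_nonneg (μ := F) (s := Set.univ))
  have e2 := Real.sq_sqrt (measureReal_nonneg (μ := F) (s := A))
  have e3 : 0 ≤ 2 * (C * Real.sqrt (F.real Set.univ)) * (D * Real.sqrt (F.real A)) := by positivity
  calc _ = (C * Real.sqrt (F.real Set.univ)) ^ 2 + (D * Real.sqrt (F.real A)) ^ 2 := by
        rw [mul_pow, mul_pow, e1, e2]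
    _ ≤ _ := by rw [add_sq]; linarith

theorem continuous_cardinalSum (n : ℕ) (s : ℝ) : Continuous (cardinalSum n s) := by
  unfold cardinalSum
  fun_prop

end WKS

/-! ### The error bound. -/

/-- The boundedness clause gives `sSup` its meaning, since on an unbounded set of reals it is `0` by
convention. -/
theorem corollary1 {Ω : Type*} [MeasurableSpace Ω] (P : Measure Ω) [IsProbabilityMeasure P]
    (X : ℝ → Ω → ℝ) (hX : WKS.IsStationaryProcess P X)
    (F : Measure ℝ) [IsFiniteMeasure F] (hF : WKS.IsSpectralMeasure P X F)
    (ω Λ T : ℝ) (n : ℕ) (hΛ : 0 < Λ) (hΛω : Λ < ω) (hT : 0 < T) (hn : 1 ≤ n)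
    (hz : WKS.zStar ω T n ∈ Set.Ioo (0 : ℝ) 1) :
    BddAbove ((fun t => WKS.rmsError P X ω n t) '' Set.Icc 0 T) ∧
      sSup ((fun t => WKS.rmsError P X ω n t) '' Set.Icc 0 T) ≤
        WKS.ATilde (WKS.covariance P X 0) F ω n T Λ := by
  have hpi := Real.pi_pos
  have hω : 0 < ω := hΛ.trans hΛω
  have hn0 : (0 : ℝ) < n := by exact_mod_cast hn
  obtain ⟨hz0, hz1⟩ := hz
  set a : ℝ := ω * T / Real.pi with ha
  have ha0 : 0 < a := by positivity
  have hza : a ^ 2 = WKS.zStar ω T n * n ^ 2 := by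
    rw [WKS.zStar, ha]
    field_simp
  have han : a < n := lt_of_pow_lt_pow_left₀ 2 hn0.le (by nlinarith [pow_pos hn0 2])
  have hr : Λ / ω < 1 := (div_lt_one hω).2 hΛω
  have hr' : 0 < 1 - Λ / ω := by linarith
  set Q : ℝ := 4 * ω * T / (Real.pi ^ 2 * (1 - WKS.zStar ω T n)) +
    4 * (WKS.zStar ω T n + 1 + 1 / (n : ℝ)) /
      (Real.pi * (1 - WKS.zStar ω T n) ^ 2 * (1 - Λ / ω)) with hQ
  have hz' : 0 < 1 - WKS.zStar ω T n := by linarith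
  have hQ0 : 0 ≤ Q := by positivity
  have hSi := WKS.Si_pi_nonneg
  have hD0 : 0 ≤ WKS.DTilde ω n T := by
    have : 0 < (n : ℝ) - ω * T / Real.pi := by linarith
    unfold WKS.DTilde
    positivity
  -- The kernel bound is stronger than needed: the target exceeds it by the factor `2` in the first
  -- term and by `2(z* + 1 + 1/n)/(1 - z*) ≥ 1` in the second.
  have hCQ : 2 / (Real.pi * n * (1 - WKS.zStar ω T n)) * (a + 1 / (1 - Λ / ω)) ≤ Q / n := by
    have h1 : 2 / (Real.pi * n * (1 - WKS.zStar ω T n)) * a ≤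
        4 * ω * T / (Real.pi ^ 2 * (1 - WKS.zStar ω T n)) / n := by
      have e : 4 * ω * T / (Real.pi ^ 2 * (1 - WKS.zStar ω T n)) / n =
          2 * (2 / (Real.pi * n * (1 - WKS.zStar ω T n)) * a) := by
        rw [ha]; field_simp; ring
      have : 0 ≤ 2 / (Real.pi * n * (1 - WKS.zStar ω T n)) * a := by positivity
      linarith
    have h2 : 2 / (Real.pi * n * (1 - WKS.zStar ω T n)) * (1 / (1 - Λ / ω)) ≤
        4 * (WKS.zStar ω T n + 1 + 1 / (n : ℝ)) /
          (Real.pi * (1 - WKS.zStar ω T n) ^ 2 * (1 - Λ / ω)) / n := by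
      have e : 4 * (WKS.zStar ω T n + 1 + 1 / (n : ℝ)) /
          (Real.pi * (1 - WKS.zStar ω T n) ^ 2 * (1 - Λ / ω)) / n =
          2 / (Real.pi * n * (1 - WKS.zStar ω T n)) * (1 / (1 - Λ / ω)) *
            (2 * (WKS.zStar ω T n + 1 + 1 / (n : ℝ)) / (1 - WKS.zStar ω T n)) := by
        generalize 1 - Λ / ω = ρ at *
        field_simp
        ring
      rw [e]
      refine le_mul_of_one_le_right (by positivity) ?_
      rw [le_div_iff₀ hz']
      have : 0 < 1 / (n : ℝ) := by positivity
      linarith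
    rw [mul_add, hQ, add_div]
    exact add_le_add h1 h2
  have hbound : ∀ t ∈ Set.Icc 0 T,
      WKS.rmsError P X ω n t ≤ WKS.ATilde (WKS.covariance P X 0) F ω n T Λ := by
    intro t ht
    have hs0 : 0 ≤ ω * t / Real.pi := div_nonneg (mul_nonneg hω.le ht.1) hpi.le
    have hsa : ω * t / Real.pi ≤ a := by
      rw [ha]
      have := ht.2
      gcongr
    have hcont := (WKS.continuous_cardinalSum n (ω * t / Real.pi)).comp
      (by fun_prop : Continuous fun l : ℝ => Real.pi * l / ω)
    have hmain := WKS.sqrt_integral_sq_le (F := F) (Λ := Λ) (C := Q / n) (D := WKS.DTilde ω n T)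
      (g := fun l : ℝ => ‖Complex.exp (Complex.I * t * l) -
        WKS.cardinalSum n (ω * t / Real.pi) (Real.pi * l / ω)‖)
      (Continuous.measurable (Continuous.norm (Continuous.sub (by fun_prop) hcont)))
      (fun l => norm_nonneg _) (by positivity) hD0 (fun l hl => ?_) (fun l => ?_)
    · rw [WKS.rmsError, WKS.integral_sq_error_eq hX hF hω.ne']
      refine hmain.trans_eq ?_
      rw [WKS.ATilde, WKS.CTilde, ← hQ, WKS.covariance_zero_eq hF,
        Real.sqrt_mul measureReal_nonneg, Real.sqrt_sq hQ0]
      ring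
    · refine le_trans ?_ hCQ
      have hθ : |Real.pi * l / ω| ≤ Real.pi * (Λ / ω) := by
        rw [abs_div, abs_mul, abs_of_pos hpi, abs_of_pos hω, mul_div_assoc]
        gcongr
      have h := WKS.norm_exp_sub_cardinalSum_le hn hs0 hsa hza hz0.le hz1 hr hθ
      have e : Complex.I * t * l =
          Complex.I * ((ω * t / Real.pi : ℝ) : ℂ) * ((Real.pi * l / ω : ℝ) : ℂ) := by
        have h1 := Complex.ofReal_ne_zero.2 hpi.ne'
        have h2 := Complex.ofReal_ne_zero.2 hω.ne'
        push_cast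
        field_simp
      rw [e]
      exact h
    -- `D̃` is the uniform bound plus `1` for the exponential.
    · have h := WKS.norm_cardinalSum_le hs0 hsa han (Real.pi * l / ω)
      refine (norm_sub_le _ _).trans ?_
      rw [WKS.norm_exp_I_mul, WKS.DTilde]
      linarith
  constructor
  · exact ⟨_, Set.forall_mem_image.2 hbound⟩
  · exact csSup_le ((Set.nonempty_Icc.2 hT.le).image _) (Set.forall_mem_image.2 hbound)
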